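/- Let $Q=(q_n)_{n\ge 1}$ be a basic sequence, i.e. a sequence of integers $q_n\ge 2$. Every real $x$ has a unique $Q$-Cantor series expansion $x=\lfloor x\rfloor+\sum_{n\ge1}\frac{E_n}{q_1\cdots q_n}$ with $E_n\in\{0,\dots,q_n-1\}$ for all $n$ and $E_n\ne q_n-1$ for infinitely many $n$. For a block $B$ of length $k$ (a $k$-tuple of non-negative integers) let $N_n^Q(B,x)$ be the number of positions $j\in\{1,\dots,n\}$ with $(E_j,\dots,E_{j+k-1})=B$, and put $Q_n^{(k)}=\sum_{j=1}^n\frac1{q_jq_{j+1}\cdots q_{j+k-1}}$ and $T_{Q,n}(x)=q_1\cdots q_n\,x \bmod 1\in[0,1)$. A real number $x$ is * *$Q$-normal of order $k$* if $\lim_{n\to\infty} N_n^Q(B,x)/Q_n^{(k)}=1$ for all blocks $B$ of length $k$, and *simply $Q$-normal* if it is $Q$-normal of order $1$; * *$Q$-ratio normal of order $k$* if $\lim_{n\to\infty} N_n^Q(B,x)/N_n^Q(B',x)=1$ for all blocks $B,B'$ of length $k$; * *$Q$-distribution normal* if $(T_{Q,n}(x))_{n\ge1}$ is uniformly distributed mod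 $1$; * *strongly $Q$-distribution normal* if $(T_{Q,kn+p}(x))_{n\ge1}$ is uniformly distributed mod $1$ for all integers $k\ge 1$ and $1\le p\le k$. Here $(x_n)_{n\ge1}$ is uniformly distributed mod $1$ if $\lim_{N\to\infty}\frac1N\#\{1\le n\le N: x_n-\lfloor x_n\rfloor\in[a,b]\}=b-a$ whenever $0\le a<b<1$. **Corollary.** Let $Q$ be a basic sequence. 1. If $q_n\to\infty$, then each of the following subsets of $\mathbb R$ has Hausdorff dimension $1$: the set of real numbers that are not $Q$-ratio normal of order $2$, the set of those that are not $Q$-distribution normal, and the set of those that are not $Q$-normal of order $2$. 2. If $\lim_{n\to\infty}Q_n^{(1)}=\infty$, then the set of real numbers that are not simply $Q$-normal has Hausdorff dimension $1$. 3. The set of real numbers that are not strongly $Q$-distribution normal has Hausdorff dimension $1$. -/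

import Mathlib

open Filter Topology

/-! Sequences are indexed from `1`, as is usual for Cantor series: a basic sequence
`(q 1, q 2, ...)` is a function `q : ℕ → ℕ` whose value `q 0` is never used. -/

/-- `q` is a basic sequence: every `q n` (`n ≥ 1`) is an integer `≥ 2`. -/
def IsBasicSequence (q : ℕ → ℕ) : Prop :=
  ∀ n : ℕ, 1 ≤ n → 2 ≤ q n

/-- The product `q 1 * q 2 * ... * q n`. -/
def cantorProd (q : ℕ → ℕ) (n : ℕ) : ℕ :=
  ∏ i ∈ Finset.Icc 1 n, q i

/-- The map `T_{Q,n}(x) = q 1 * ... * q n * x (mod 1)`, with values in `[0,1)`. -/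
noncomputable def cantorT (q : ℕ → ℕ) (n : ℕ) (x : ℝ) : ℝ :=
  Int.fract ((cantorProd q n : ℝ) * x)

/-- `(E 1, E 2, ...)` is the sequence of digits of the `Q`-Cantor series expansion of `x`:
`x = ⌊x⌋ + ∑_{n ≥ 1} E n / (q 1 ⋯ q n)`, with `E n ∈ {0, ..., q n - 1}` for all `n ≥ 1` and
`E n ≠ q n - 1` infinitely often. -/
structure IsCantorSeries (q : ℕ → ℕ) (x : ℝ) (E : ℕ → ℕ) : Prop where
  digit_lt : ∀ n : ℕ, 1 ≤ n → E n < q n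
  infinitely_often : ∃ᶠ n in atTop, E n + 1 ≠ q n
  hasSum : HasSum (fun n : ℕ => (E (n + 1) : ℝ) / (cantorProd q (n + 1) : ℝ)) (x - (⌊x⌋ : ℝ))

/-- The `n`-th digit (`n ≥ 1`) of the `Q`-Cantor series expansion of `x`. By
`isCantorSeries_cantorDigit` and `IsCantorSeries.eq_cantorDigit` below, these are the digits of
the one and only expansion in the sense of `IsCantorSeries`. -/
noncomputable def cantorDigit (q : ℕ → ℕ) (x : ℝ) (n : ℕ) : ℕ :=
  ⌊(q n : ℝ) * cantorT q (n - 1) x⌋₊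

/-- `N_n^Q(B, x)`: the number of times the block `B` of length `k` occurs, starting at a position
in `{1, ..., n}`, in the `Q`-Cantor series expansion of `x`. Every `k`-tuple of nonnegative
integers is a block of length `k` (in some base). -/
noncomputable def blockCount (q : ℕ → ℕ) {k : ℕ} (B : Fin k → ℕ) (n : ℕ) (x : ℝ) : ℕ :=
  ((Finset.Icc 1 n).filter fun j => ∀ i : Fin k, cantorDigit q x (j + i) = B i).card

/-- `Q_n^{(k)} = ∑_{j=1}^n 1 / (q j * q (j+1) * ... * q (j+k-1))`. -/
noncomputable def blockMean (q : ℕ → ℕ) (k n : ℕ) : ℝ :=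
  ∑ j ∈ Finset.Icc 1 n, 1 / ∏ i ∈ Finset.range k, (q (j + i) : ℝ)

/-- `x` is `Q`-normal of order `k`. -/
def IsQNormalOfOrder (q : ℕ → ℕ) (k : ℕ) (x : ℝ) : Prop :=
  ∀ B : Fin k → ℕ,
    Tendsto (fun n : ℕ => (blockCount q B n x : ℝ) / blockMean q k n) atTop (𝓝 1)

/-- `x` is simply `Q`-normal, that is, `Q`-normal of order `1`. -/
def IsSimplyQNormal (q : ℕ → ℕ) (x : ℝ) : Prop :=
  IsQNormalOfOrder q 1 x

/-- `x` is `Q`-ratio normal of order `k`. (If `B'` never occurs, the quotient below is constantly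
`0` and does not tend to `1`, so that `x` is not ratio normal, as it should be.) -/
def IsQRatioNormalOfOrder (q : ℕ → ℕ) (k : ℕ) (x : ℝ) : Prop :=
  ∀ B B' : Fin k → ℕ,
    Tendsto (fun n : ℕ => (blockCount q B n x : ℝ) / (blockCount q B' n x : ℝ)) atTop (𝓝 1)

open Classical in
/-- `A_N(I, X)`: the number of `n ∈ {1, ..., N}` such that the fractional part of `X n` is
in `I`. -/
noncomputable def fractCount (I : Set ℝ) (X : ℕ → ℝ) (N : ℕ) : ℕ :=
  ((Finset.Icc 1 N).filter fun n => Int.fract (X n) ∈ I).card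

/-- The sequence `(X 1, X 2, ...)` is uniformly distributed mod `1`. -/
def IsUniformlyDistributedModOne (X : ℕ → ℝ) : Prop :=
  ∀ a b : ℝ, 0 ≤ a → a < b → b < 1 →
    Tendsto (fun N : ℕ => (fractCount (Set.Icc a b) X N : ℝ) / (N : ℝ)) atTop (𝓝 (b - a))

/-- `x` is `Q`-distribution normal. -/
def IsQDistributionNormal (q : ℕ → ℕ) (x : ℝ) : Prop :=
  IsUniformlyDistributedModOne fun n => cantorT q n x

/-- `x` is strongly `Q`-distribution normal. -/
def IsStronglyQDistributionNormal (q : ℕ → ℕ) (x : ℝ) : Prop :=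
  ∀ k p : ℕ, 1 ≤ k → 1 ≤ p → p ≤ k →
    IsUniformlyDistributedModOne fun n => cantorT q (k * n + p) x

/-- `Q` is infinite in limit: `q n → ∞`. -/
def IsInfiniteInLimit (q : ℕ → ℕ) : Prop :=
  Tendsto q atTop atTop

/-- `Q` is `k`-divergent: `Q_n^{(k)} → ∞`. -/
def IsKDivergent (q : ℕ → ℕ) (k : ℕ) : Prop :=
  Tendsto (blockMean q k) atTop atTop

/-! Existence and uniqueness of the expansion; these facts justify `cantorDigit`. -/

theorem cantorProd_succ (q : ℕ → ℕ) (n : ℕ) :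
    cantorProd q (n + 1) = cantorProd q n * q (n + 1) := by
  unfold cantorProd
  rw [Finset.prod_Icc_succ_top (by omega)]

theorem IsBasicSequence.two_pow_le {q : ℕ → ℕ} (hq : IsBasicSequence q) (n : ℕ) :
    2 ^ n ≤ cantorProd q n := by
  induction n with
  | zero => simp [cantorProd]
  | succ n ih =>
    rw [cantorProd_succ, pow_succ]
    exact Nat.mul_le_mul ih (hq _ (by omega))

theorem IsBasicSequence.cantorProd_pos {q : ℕ → ℕ} (hq : IsBasicSequence q) (n : ℕ) :
    (0 : ℝ) < (cantorProd q n : ℝ) := by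
  exact_mod_cast lt_of_lt_of_le (by positivity) (hq.two_pow_le n)

theorem IsBasicSequence.tendsto_inv {q : ℕ → ℕ} (hq : IsBasicSequence q) :
    Tendsto (fun n => 1 / (cantorProd q n : ℝ)) atTop (𝓝 0) := by
  refine squeeze_zero (fun n => by positivity) (fun n => ?_)
    (tendsto_pow_atTop_nhds_zero_of_lt_one (r := (1 / 2 : ℝ)) (by norm_num) (by norm_num))
  rw [one_div_pow]
  exact one_div_le_one_div_of_le (by positivity) (by exact_mod_cast hq.two_pow_le n)

theorem cantorT_succ (q : ℕ → ℕ) (x : ℝ) (n : ℕ) :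
    cantorT q (n + 1) x = q (n + 1) * cantorT q n x - cantorDigit q x (n + 1) := by
  have h0 : (0 : ℝ) ≤ (q (n + 1) : ℝ) * cantorT q n x :=
    mul_nonneg (Nat.cast_nonneg _) (Int.fract_nonneg _)
  have h1 : (cantorDigit q x (n + 1) : ℝ) = (⌊(q (n + 1) : ℝ) * cantorT q n x⌋ : ℝ) := by
    unfold cantorDigit
    rw [Nat.add_sub_cancel]
    exact natCast_floor_eq_intCast_floor h0
  rw [h1]
  change _ = Int.fract ((q (n + 1) : ℝ) * cantorT q n x)
  unfold cantorT
  rw [cantorProd_succ, Int.fract_eq_fract]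
  refine ⟨q (n + 1) * ⌊(cantorProd q n : ℝ) * x⌋, ?_⟩
  have := Int.self_sub_floor ((cantorProd q n : ℝ) * x)
  push_cast
  rw [← this]
  ring

/-- If `R (n+1) = q (n+1) * R n - E (n+1)` and `R ≤ 1` throughout, with `E < q` and `E ≠ q - 1`
infinitely often, then `R < 1` throughout; and conversely. -/
theorem cantor_remainder {q E : ℕ → ℕ} {R : ℕ → ℝ} (hq : IsBasicSequence q)
    (hR : ∀ n, R (n + 1) = q (n + 1) * R n - E (n + 1)) (h0 : ∀ n, 0 ≤ R n) (h1 : ∀ n, R n ≤ 1)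
    (hE : ∀ n, 1 ≤ n → E n < q n) :
    (∃ᶠ n in atTop, E n + 1 ≠ q n) ↔ ∀ n, R n < 1 := by
  constructor
  · intro hf N
    by_contra hN
    have hN1 : R N = 1 := le_antisymm (h1 N) (not_lt.mp hN)
    have hall : ∀ m, R (N + m) = 1 := by
      intro m
      induction m with
      | zero => simpa using hN1
      | succ m ih =>
        have h2 := hR (N + m)
        have h3 : (E (N + m + 1) : ℝ) + 1 ≤ q (N + m + 1) := by
          exact_mod_cast hE (N + m + 1) (by omega)
        rw [ih] at h2
        refine le_antisymm (h1 _) ?_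
        rw [← add_assoc, h2]
        linarith
    refine hf ?_
    filter_upwards [eventually_ge_atTop (N + 1)] with n hn
    obtain ⟨m, rfl⟩ := Nat.exists_eq_add_of_le hn
    have h2 := hR (N + m)
    have h3 := hall (m + 1)
    rw [← add_assoc] at h3
    rw [hall m, h3] at h2
    have h4 : (E (N + m + 1) : ℝ) + 1 = q (N + m + 1) := by linarith
    rw [show N + 1 + m = N + m + 1 by omega]
    simpa using (by exact_mod_cast h4 : E (N + m + 1) + 1 = q (N + m + 1))
  · intro hlt hf
    obtain ⟨N, hN⟩ := eventually_atTop.mp hf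
    have hgrow : ∀ m, 2 ^ m * (1 - R N) ≤ 1 - R (N + m) := by
      intro m
      induction m with
      | zero => simp
      | succ m ih =>
        have h2 := hR (N + m)
        have h3 : E (N + m + 1) + 1 = q (N + m + 1) := by
          simpa using hN (N + m + 1) (by omega)
        have h4 : (E (N + m + 1) : ℝ) + 1 = q (N + m + 1) := by exact_mod_cast h3
        have h5 : (2 : ℝ) ≤ q (N + m + 1) := by exact_mod_cast hq (N + m + 1) (by omega)
        have h6 := hlt (N + m)
        rw [← add_assoc, h2, pow_succ]
        nlinarith
    have hpos : 0 < 1 - R N := by linarith [hlt N]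
    obtain ⟨m, hm⟩ := pow_unbounded_of_one_lt (1 / (1 - R N)) (one_lt_two)
    rw [div_lt_iff₀ hpos] at hm
    linarith [hgrow m, h0 (N + m)]

theorem cantorDigit_lt {q : ℕ → ℕ} (hq : IsBasicSequence q) (x : ℝ) (n : ℕ) (hn : 1 ≤ n) :
    cantorDigit q x n < q n := by
  have h2 : (2 : ℝ) ≤ q n := by exact_mod_cast hq n hn
  have hT0 : 0 ≤ cantorT q (n - 1) x := Int.fract_nonneg _
  have hT1 : cantorT q (n - 1) x < 1 := Int.fract_lt_one _
  unfold cantorDigit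
  rw [Nat.floor_lt (by positivity)]
  nlinarith

/-- Every real number has a `Q`-Cantor series expansion, with digits `cantorDigit q x`. -/
theorem isCantorSeries_cantorDigit {q : ℕ → ℕ} (hq : IsBasicSequence q) (x : ℝ) :
    IsCantorSeries q x (cantorDigit q x) where
  digit_lt := cantorDigit_lt hq x
  infinitely_often :=
    (cantor_remainder (R := fun n => cantorT q n x) hq (cantorT_succ q x)
      (fun _ => Int.fract_nonneg _)
      (fun _ => (Int.fract_lt_one _).le) (cantorDigit_lt hq x)).mpr fun _ => Int.fract_lt_one _
  hasSum := by
    rw [hasSum_iff_tendsto_nat_of_nonneg (fun n => by positivity)]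
    have hsum : ∀ N, ∑ n ∈ Finset.range N,
        (cantorDigit q x (n + 1) : ℝ) / (cantorProd q (n + 1) : ℝ)
          = (x - ⌊x⌋) - cantorT q N x * (1 / (cantorProd q N : ℝ)) := by
      intro N
      induction N with
      | zero => simp [cantorT, cantorProd]
      | succ N ih =>
        have hp := hq.cantorProd_pos N
        have h2 : (0 : ℝ) < q (N + 1) := by
          exact_mod_cast lt_of_lt_of_le two_pos (hq (N + 1) (by omega))
        rw [Finset.sum_range_succ, ih, cantorT_succ, cantorProd_succ]
        push_cast
        field_simp
        ring
    simp_rw [hsum]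
    have hz : Tendsto (fun N => cantorT q N x * (1 / (cantorProd q N : ℝ))) atTop (𝓝 0) := by
      refine squeeze_zero
        (fun n => mul_nonneg (Int.fract_nonneg _) (by positivity)) (fun n => ?_) hq.tendsto_inv
      exact mul_le_of_le_one_left (by positivity) (Int.fract_lt_one _).le
    simpa using tendsto_const_nhds.sub hz

/-- The `Q`-Cantor series expansion is unique. -/
theorem IsCantorSeries.eq_cantorDigit {q : ℕ → ℕ} (hq : IsBasicSequence q) {x : ℝ} {E : ℕ → ℕ}
    (h : IsCantorSeries q x E) (n : ℕ) (hn : 1 ≤ n) : E n = cantorDigit q x n := by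
  set S : ℕ → ℝ := fun N => ∑ n ∈ Finset.range N, (E (n + 1) : ℝ) / (cantorProd q (n + 1) : ℝ)
    with hS
  have hlim : Tendsto S atTop (𝓝 (x - ⌊x⌋)) := h.hasSum.tendsto_sum_nat
  set R : ℕ → ℝ := fun N => (cantorProd q N : ℝ) * ((x - ⌊x⌋) - S N) with hRdef
  have hR : ∀ n, R (n + 1) = q (n + 1) * R n - E (n + 1) := by
    intro N
    have hp := hq.cantorProd_pos N
    have h2 : (0 : ℝ) < q (N + 1) := by
      exact_mod_cast lt_of_lt_of_le two_pos (hq (N + 1) (by omega))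
    simp only [hRdef, hS, Finset.sum_range_succ, cantorProd_succ]
    push_cast
    field_simp
    ring
  have hR0 : ∀ n, 0 ≤ R n := fun N => by
    refine mul_nonneg (Nat.cast_nonneg _) (sub_nonneg.mpr ?_)
    exact sum_le_hasSum _ (fun n _ => by positivity) h.hasSum
  have hmono : Antitone fun N => S N + 1 / (cantorProd q N : ℝ) := by
    refine antitone_nat_of_succ_le fun N => ?_
    have hp := hq.cantorProd_pos N
    have h2 : (0 : ℝ) < q (N + 1) := by
      exact_mod_cast lt_of_lt_of_le two_pos (hq (N + 1) (by omega))
    have h3 : (E (N + 1) : ℝ) + 1 ≤ q (N + 1) := by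
      exact_mod_cast h.digit_lt (N + 1) (by omega)
    have h4 : (E (N + 1) : ℝ) / (cantorProd q (N + 1) : ℝ) + 1 / (cantorProd q (N + 1) : ℝ)
        ≤ 1 / (cantorProd q N : ℝ) := by
      rw [← add_div, cantorProd_succ]
      push_cast
      rw [div_le_div_iff₀ (by positivity) hp]
      nlinarith
    simp only [hS, Finset.sum_range_succ]
    linarith
  have hR1 : ∀ n, R n ≤ 1 := fun N => by
    have hp := hq.cantorProd_pos N
    have hl : Tendsto (fun N => S N + 1 / (cantorProd q N : ℝ)) atTop (𝓝 (x - ⌊x⌋)) := by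
      simpa using hlim.add hq.tendsto_inv
    have h5 := hmono.le_of_tendsto hl N
    have h6 : (x - ⌊x⌋) - S N ≤ 1 / (cantorProd q N : ℝ) := by linarith
    calc R N ≤ (cantorProd q N : ℝ) * (1 / (cantorProd q N : ℝ)) :=
          mul_le_mul_of_nonneg_left h6 hp.le
      _ = 1 := by field_simp
  have hlt := (cantor_remainder hq hR hR0 hR1 h.digit_lt).mp h.infinitely_often
  have hdig : ∀ n, R n = cantorT q n x → E (n + 1) = cantorDigit q x (n + 1) := by
    intro n hn
    unfold cantorDigit
    rw [Nat.add_sub_cancel, ← hn, eq_comm,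
      Nat.floor_eq_iff (mul_nonneg (Nat.cast_nonneg _) (hR0 n))]
    constructor <;> linarith [hR n, hR0 (n + 1), hlt (n + 1)]
  have hRT : ∀ n, R n = cantorT q n x := by
    intro n
    induction n with
    | zero => simp [hRdef, hS, cantorT, cantorProd]
    | succ n ih => rw [hR, cantorT_succ, ih, hdig n ih]
  obtain ⟨m, rfl⟩ := Nat.exists_eq_add_of_le' hn
  exact hdig m (hRT m)

/-!
Numbers that fail to be normal are produced by restricting the digit at position `j` to a window
`{a j, ..., a j + M j - 1}` of consecutive digits which contains at least half of all digits.
The point `y ∈ [0, 1)` with digits `F j` in base `M` corresponds to the point `x` with digits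
`a j + F j` in base `q`. As the admissible digits are consecutive, `y` and `y'` are separated by
at most as many cylinders of base `M` as there are cylinders of base `q` between `x` and `x'`
(`IsDigitWindow.abs_floor_sub_le`). Comparing at the first level at which the cylinders are
shorter than `|x - x'|`, the map `x ↦ y` is Hölder continuous with exponent `s` as soon as
`(q 1 ⋯ q n) ^ s ≤ C * (M 1 ⋯ M n)`. Hence every set of points `y` of dimension `1` gives rise to
a set of points `x` of dimension at least `s` (`IsDigitWindow.mul_dimH_le`), and it remains to
choose, for each `s < 1`, windows which force `x` to be non-normal.

If `q n → ∞`, windows may be imposed at every position, since `2 ^ n` is smaller than any power of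
`q 1 ⋯ q n`. Digits in the lower half and different from `0` prevent the block `(0, 0)` from
occurring, and keep `T_{Q,n}(x)` eventually below `3 / 4`.

For a general basic sequence, windows are imposed only at positions in one residue class modulo a
large `k`. Digits in the lower half at positions `≡ 1` modulo `k` keep `T_{Q,kn+k}(x)` below
`3 / 4`, which contradicts strong distribution normality. For simple normality, the digit `0` is
forbidden at the positions in a residue class which carries at least the proportion `1 / (2 k)` of
`Q_n^{(1)}` for infinitely many `n`. When `y` is chosen uniformly at random, the expected number
of zeros among the first `n` digits is then at most `(1 - 1 / (2 k)) * Q_n^{(1)}` infinitely often,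
so that by Fatou's lemma the points `y` whose `x` is not simply normal have positive Lebesgue measure
(`volume_not_tendsto_count_zero_ne_zero`), hence dimension `1`.
-/

/-! ### Integer parts and digits -/

theorem natCast_cantorDigit (q : ℕ → ℕ) (x : ℝ) (n : ℕ) :
    (cantorDigit q x (n + 1) : ℝ) = q (n + 1) * cantorT q n x - cantorT q (n + 1) x := by
  rw [cantorT_succ]; ring

theorem floor_cantorProd_succ_mul (q : ℕ → ℕ) (x : ℝ) (n : ℕ) :
    ⌊(cantorProd q (n + 1) : ℝ) * x⌋
      = q (n + 1) * ⌊(cantorProd q n : ℝ) * x⌋ + cantorDigit q x (n + 1) := by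
  have h := natCast_cantorDigit q x n
  have h1 := Int.self_sub_fract ((cantorProd q n : ℝ) * x)
  have h2 := Int.self_sub_fract ((cantorProd q (n + 1) : ℝ) * x)
  have h3 : (cantorProd q (n + 1) : ℝ) = cantorProd q n * q (n + 1) := by
    exact_mod_cast cantorProd_succ q n
  change _ = _ * Int.fract _ - Int.fract _ at h
  have : (⌊(cantorProd q (n + 1) : ℝ) * x⌋ : ℝ)
      = q (n + 1) * ⌊(cantorProd q n : ℝ) * x⌋ + cantorDigit q x (n + 1) := by
    rw [h, ← h1, ← h2, h3]; ring
  exact_mod_cast this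

theorem cantorDigit_lt_of_pos {q : ℕ → ℕ} (x : ℝ) {n : ℕ} (hn : 1 ≤ q n) :
    cantorDigit q x n < q n := by
  have h2 : (1 : ℝ) ≤ q n := by exact_mod_cast hn
  have hT0 : 0 ≤ cantorT q (n - 1) x := Int.fract_nonneg _
  have hT1 : cantorT q (n - 1) x < 1 := Int.fract_lt_one _
  unfold cantorDigit
  rw [Nat.floor_lt (by positivity)]
  nlinarith

/-! ### Real numbers with prescribed digits -/

/-- Every admissible sequence of digits is the expansion of a number in `[0, 1)`. -/
theorem exists_isCantorSeries {q E : ℕ → ℕ} (hq : IsBasicSequence q)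
    (hE : ∀ n, 1 ≤ n → E n < q n) (hf : ∃ᶠ n in atTop, E n + 1 ≠ q n) :
    ∃ x ∈ Set.Ico (0 : ℝ) 1, IsCantorSeries q x E := by
  set S : ℕ → ℝ := fun N => ∑ n ∈ Finset.range N, (E (n + 1) : ℝ) / (cantorProd q (n + 1) : ℝ)
    with hS
  have hmono : Monotone S := monotone_nat_of_le_succ fun N => by
    simp only [hS, Finset.sum_range_succ]
    linarith [show 0 ≤ (E (N + 1) : ℝ) / (cantorProd q (N + 1) : ℝ) by positivity]
  have hanti : Antitone fun N => S N + 1 / (cantorProd q N : ℝ) := by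
    refine antitone_nat_of_succ_le fun N => ?_
    have hp := hq.cantorProd_pos N
    have hp' := hq.cantorProd_pos (N + 1)
    have h3 : (E (N + 1) : ℝ) + 1 ≤ q (N + 1) := by
      exact_mod_cast hE (N + 1) (by omega)
    have h4 : (E (N + 1) : ℝ) / (cantorProd q (N + 1) : ℝ) + 1 / (cantorProd q (N + 1) : ℝ)
        ≤ 1 / (cantorProd q N : ℝ) := by
      rw [← add_div, div_le_div_iff₀ hp' hp, cantorProd_succ]
      push_cast
      nlinarith
    simp only [hS, Finset.sum_range_succ]
    linarith
  have hbdd : BddAbove (Set.range S) := ⟨1, by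
    rintro _ ⟨N, rfl⟩
    have h1 := hanti (Nat.zero_le N)
    have h2 : (0 : ℝ) ≤ 1 / (cantorProd q N : ℝ) := by positivity
    have h3 : S 0 + 1 / (cantorProd q 0 : ℝ) = 1 := by simp [hS, cantorProd]
    linarith⟩
  obtain ⟨x, hx⟩ : ∃ x, Tendsto S atTop (𝓝 x) := ⟨_, tendsto_atTop_ciSup hmono hbdd⟩
  have hsum : HasSum (fun n : ℕ => (E (n + 1) : ℝ) / (cantorProd q (n + 1) : ℝ)) x :=
    (hasSum_iff_tendsto_nat_of_nonneg (fun n => by positivity) _).mpr hx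
  set R : ℕ → ℝ := fun N => (cantorProd q N : ℝ) * (x - S N) with hRdef
  have hR : ∀ n, R (n + 1) = q (n + 1) * R n - E (n + 1) := by
    intro N
    have hp := hq.cantorProd_pos N
    have h2 : (0 : ℝ) < q (N + 1) := by
      exact_mod_cast lt_of_lt_of_le two_pos (hq (N + 1) (by omega))
    simp only [hRdef, hS, Finset.sum_range_succ, cantorProd_succ]
    push_cast
    field_simp
    ring
  have hR0 : ∀ n, 0 ≤ R n := fun N =>
    mul_nonneg (Nat.cast_nonneg _) (sub_nonneg.mpr (hmono.ge_of_tendsto hx N))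
  have hR1 : ∀ n, R n ≤ 1 := fun N => by
    have hp := hq.cantorProd_pos N
    have h5 := hanti.le_of_tendsto (by simpa using hx.add hq.tendsto_inv) N
    have h6 : x - S N ≤ 1 / (cantorProd q N : ℝ) := by linarith
    calc R N ≤ (cantorProd q N : ℝ) * (1 / (cantorProd q N : ℝ)) :=
          mul_le_mul_of_nonneg_left h6 hp.le
      _ = 1 := by field_simp
  have hx0 : R 0 = x := by simp [hRdef, hS, cantorProd]
  have hlt := (cantor_remainder hq hR hR0 hR1 hE).mp hf 0
  have hxI : x ∈ Set.Ico (0 : ℝ) 1 := ⟨hx0 ▸ hR0 0, hx0 ▸ hlt⟩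
  refine ⟨x, hxI, hE, hf, ?_⟩
  rwa [Int.floor_eq_zero_iff.mpr hxI, Int.cast_zero, sub_zero]

/-! ### Digits restricted to windows -/

/-- A choice, at every position `j ≥ 1`, of a window `{a j, ..., a j + M j - 1}` of admissible
digits which contains at least half of the digits `0, ..., q j - 1`. Windows with a single
element are allowed, so `M` need not be a basic sequence. -/
structure IsDigitWindow (q a M : ℕ → ℕ) : Prop where
  pos : ∀ j, 1 ≤ j → 1 ≤ M j
  add_le : ∀ j, 1 ≤ j → a j + M j ≤ q j
  le_two_mul : ∀ j, 1 ≤ j → q j ≤ 2 * M j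

/-- The digits of `x` in base `q` are those of `y` in base `M`, shifted by `a`. -/
def IsDigitShift (q a M : ℕ → ℕ) (y x : ℝ) : Prop :=
  ∀ j, 1 ≤ j → cantorDigit q x j = a j + cantorDigit M y j

theorem cantorProd_pos_of_pos {M : ℕ → ℕ} (hM : ∀ j, 1 ≤ j → 1 ≤ M j) (n : ℕ) :
    (0 : ℝ) < cantorProd M n := by
  exact_mod_cast Finset.prod_pos fun i hi => hM i (Finset.mem_Icc.mp hi).1

/-- The digits in base `M` are not eventually maximal, even if `M j = 1` for many `j`. -/
theorem frequently_cantorDigit_ne {M : ℕ → ℕ}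
    (hlim : Tendsto (fun n => (cantorProd M n : ℝ)) atTop atTop) (y : ℝ) :
    ∃ᶠ n in atTop, cantorDigit M y n + 1 ≠ M n := by
  intro hf
  obtain ⟨N, hN⟩ := eventually_atTop.mp hf
  -- the distance of the remainder to `1` would grow like the product of the bases
  have hgrow : ∀ m, (1 - cantorT M (N + m) y) * cantorProd M N
      = (1 - cantorT M N y) * cantorProd M (N + m) := by
    intro m
    induction m with
    | zero => simp
    | succ m ih =>
      have h3 : cantorDigit M y (N + m + 1) + 1 = M (N + m + 1) := by
        simpa using hN (N + m + 1) (by omega)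
      have h4 : (cantorDigit M y (N + m + 1) : ℝ) = M (N + m + 1) - 1 := by
        rw [← h3]; push_cast; ring
      rw [← add_assoc, cantorT_succ, cantorProd_succ, h4]
      push_cast
      linear_combination (M (N + m + 1) : ℝ) * ih
  have hpos : 0 < 1 - cantorT M N y := sub_pos.mpr (Int.fract_lt_one _)
  obtain ⟨n, hn1, hn2⟩ := ((hlim.eventually_gt_atTop
    (cantorProd M N / (1 - cantorT M N y))).and (eventually_ge_atTop N)).exists
  obtain ⟨m, rfl⟩ := Nat.exists_eq_add_of_le hn2
  rw [div_lt_iff₀ hpos] at hn1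
  have h0 : 0 ≤ cantorT M (N + m) y := Int.fract_nonneg _
  nlinarith [hgrow m, Nat.cast_nonneg (α := ℝ) (cantorProd M N)]

theorem IsDigitWindow.exists_isDigitShift {q a M : ℕ → ℕ} (h : IsDigitWindow q a M)
    (hq : IsBasicSequence q) (hlim : Tendsto (fun n => (cantorProd M n : ℝ)) atTop atTop)
    (y : ℝ) : ∃ x ∈ Set.Ico (0 : ℝ) 1, IsDigitShift q a M y x := by
  have hlt : ∀ n, 1 ≤ n → cantorDigit M y n < M n := fun n hn =>
    cantorDigit_lt_of_pos y (h.pos n hn)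
  obtain ⟨x, hx, hs⟩ := exists_isCantorSeries (E := fun j => a j + cantorDigit M y j) hq
    (fun n hn => by have := hlt n hn; have := h.add_le n hn; omega)
    (((frequently_cantorDigit_ne hlim y).and_eventually (eventually_ge_atTop 1)).mono
      fun n hn => by
        have := hlt n hn.2; have := h.add_le n hn.2; have := hn.1; omega)
  exact ⟨x, hx, fun j hj => (hs.eq_cantorDigit hq j hj).symm⟩

/-- At every level, the points `y` and `y'` are separated by at most as many cylinders of base
`M` as there are cylinders of base `q` between `x` and `x'`, since admissible digits are
consecutive. -/
theorem IsDigitWindow.abs_floor_sub_le {q a M : ℕ → ℕ} (h : IsDigitWindow q a M)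
    {x x' y y' : ℝ} (hx : x ∈ Set.Ico (0 : ℝ) 1) (hx' : x' ∈ Set.Ico (0 : ℝ) 1)
    (hy : y ∈ Set.Ico (0 : ℝ) 1) (hy' : y' ∈ Set.Ico (0 : ℝ) 1)
    (hs : IsDigitShift q a M y x) (hs' : IsDigitShift q a M y' x') (n : ℕ) :
    |⌊(cantorProd M n : ℝ) * y⌋ - ⌊(cantorProd M n : ℝ) * y'⌋|
      ≤ |⌊(cantorProd q n : ℝ) * x⌋ - ⌊(cantorProd q n : ℝ) * x'⌋| := by
  -- The two differences have the same sign, and vanish together: a difference of digits is less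
  -- than `M` in absolute value, and cannot undo a difference at an earlier level.
  set W : ℕ → ℤ := fun n => ⌊(cantorProd M n : ℝ) * y⌋ - ⌊(cantorProd M n : ℝ) * y'⌋ with hW
  set D : ℕ → ℤ := fun n => ⌊(cantorProd q n : ℝ) * x⌋ - ⌊(cantorProd q n : ℝ) * x'⌋ with hD
  have key : ∀ n, (W n = 0 ∧ D n = 0) ∨ (1 ≤ W n ∧ W n ≤ D n) ∨ (W n ≤ -1 ∧ D n ≤ W n) := by
    intro n
    induction n with
    | zero =>
      left
      have := Int.floor_eq_zero_iff.mpr hx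
      have := Int.floor_eq_zero_iff.mpr hx'
      have := Int.floor_eq_zero_iff.mpr hy
      have := Int.floor_eq_zero_iff.mpr hy'
      have hM0 : cantorProd M 0 = 1 := by simp [cantorProd]
      have hq0 : cantorProd q 0 = 1 := by simp [cantorProd]
      simp only [hW, hD, hM0, hq0, Nat.cast_one, one_mul]
      omega
    | succ n ih =>
      have hp : (1 : ℤ) ≤ M (n + 1) := by exact_mod_cast h.pos (n + 1) (by omega)
      have hMq : (M (n + 1) : ℤ) ≤ q (n + 1) := by
        exact_mod_cast (Nat.le_add_left _ _).trans (h.add_le (n + 1) (by omega))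
      have hF : (cantorDigit M y (n + 1) : ℤ) < M (n + 1) := by
        exact_mod_cast cantorDigit_lt_of_pos y (h.pos (n + 1) (by omega))
      have hF' : (cantorDigit M y' (n + 1) : ℤ) < M (n + 1) := by
        exact_mod_cast cantorDigit_lt_of_pos y' (h.pos (n + 1) (by omega))
      have hF0 : (0 : ℤ) ≤ cantorDigit M y (n + 1) := Int.natCast_nonneg _
      have hF0' : (0 : ℤ) ≤ cantorDigit M y' (n + 1) := Int.natCast_nonneg _
      have hWs : W (n + 1) = M (n + 1) * W n
          + (cantorDigit M y (n + 1) - cantorDigit M y' (n + 1)) := by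
        simp only [hW, floor_cantorProd_succ_mul]; ring
      have hDs : D (n + 1) = q (n + 1) * D n
          + (cantorDigit M y (n + 1) - cantorDigit M y' (n + 1)) := by
        simp only [hD, floor_cantorProd_succ_mul, hs (n + 1) (by omega), hs' (n + 1) (by omega)]
        push_cast; ring
      generalize (cantorDigit M y (n + 1) : ℤ) = F at *
      generalize (cantorDigit M y' (n + 1) : ℤ) = F' at *
      rw [hWs, hDs]
      rcases ih with ⟨h1, h2⟩ | ⟨h1, h2⟩ | ⟨h1, h2⟩
      · rw [h1, h2]; omega
      · right; left; constructor <;> nlinarith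
      · right; right; constructor <;> nlinarith
  change |W n| ≤ |D n|
  rcases key n with ⟨h1, h2⟩ | ⟨h1, h2⟩ | ⟨h1, h2⟩
  · rw [h1, h2]
  · rwa [abs_of_nonneg (by omega), abs_of_nonneg (by omega)]
  · rw [abs_of_nonpos (by omega), abs_of_nonpos (by omega)]; omega

theorem abs_sub_le_abs_floor_sub_add_one (u v : ℝ) : |u - v| ≤ |((⌊u⌋ - ⌊v⌋ : ℤ) : ℝ)| + 1 := by
  have h1 := Int.floor_add_fract u
  have h2 := Int.floor_add_fract v
  have h3 := Int.fract_nonneg u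
  have h4 := Int.fract_nonneg v
  have h5 := Int.fract_lt_one u
  have h6 := Int.fract_lt_one v
  have h7 : u - v = ((⌊u⌋ - ⌊v⌋ : ℤ) : ℝ) + (Int.fract u - Int.fract v) := by push_cast; linarith
  rw [h7]
  exact (abs_add_le _ _).trans (by gcongr; rw [abs_le]; constructor <;> linarith)

theorem abs_floor_sub_le_abs_sub_add_one (u v : ℝ) : |((⌊u⌋ - ⌊v⌋ : ℤ) : ℝ)| ≤ |u - v| + 1 := by
  have h1 := Int.floor_add_fract u
  have h2 := Int.floor_add_fract v
  have h3 := Int.fract_nonneg u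
  have h4 := Int.fract_nonneg v
  have h5 := Int.fract_lt_one u
  have h6 := Int.fract_lt_one v
  have h7 : ((⌊u⌋ - ⌊v⌋ : ℤ) : ℝ) = (u - v) + (Int.fract v - Int.fract u) := by push_cast; linarith
  rw [h7]
  exact (abs_add_le _ _).trans (by gcongr; rw [abs_le]; constructor <;> linarith)

theorem IsDigitWindow.cantorProd_mul_abs_sub_le {q a M : ℕ → ℕ} (h : IsDigitWindow q a M)
    {x x' y y' : ℝ} (hx : x ∈ Set.Ico (0 : ℝ) 1) (hx' : x' ∈ Set.Ico (0 : ℝ) 1)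
    (hy : y ∈ Set.Ico (0 : ℝ) 1) (hy' : y' ∈ Set.Ico (0 : ℝ) 1)
    (hs : IsDigitShift q a M y x) (hs' : IsDigitShift q a M y' x') (n : ℕ) :
    cantorProd M n * |y - y'| ≤ cantorProd q n * |x - x'| + 2 := by
  have h1 := abs_sub_le_abs_floor_sub_add_one (cantorProd M n * y) (cantorProd M n * y')
  have h2 := abs_floor_sub_le_abs_sub_add_one (cantorProd q n * x) (cantorProd q n * x')
  have h3 : |((⌊(cantorProd M n : ℝ) * y⌋ - ⌊(cantorProd M n : ℝ) * y'⌋ : ℤ) : ℝ)|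
      ≤ |((⌊(cantorProd q n : ℝ) * x⌋ - ⌊(cantorProd q n : ℝ) * x'⌋ : ℤ) : ℝ)| := by
    exact_mod_cast h.abs_floor_sub_le hx hx' hy hy' hs hs' n
  rw [← mul_sub, abs_mul, Nat.abs_cast] at h1 h2
  linarith

theorem pos_of_cantorProd_rpow_le {q M : ℕ → ℕ} {s C : ℝ}
    (hC : ∀ n, (cantorProd q n : ℝ) ^ s ≤ C * cantorProd M n) : 0 < C := by
  have h0 := hC 0
  simp only [cantorProd, zero_lt_one, Finset.Icc_eq_empty_of_lt, Finset.prod_empty,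
    Nat.cast_one, Real.one_rpow, mul_one] at h0
  linarith

theorem IsBasicSequence.tendsto_cantorProd_rpow {q : ℕ → ℕ} (hq : IsBasicSequence q) {s : ℝ}
    (hs : 0 < s) : Tendsto (fun n => (cantorProd q n : ℝ) ^ s) atTop atTop :=
  (tendsto_rpow_atTop hs).comp (tendsto_natCast_atTop_atTop.comp
    (tendsto_atTop_mono hq.two_pow_le (tendsto_pow_atTop_atTop_of_one_lt one_lt_two)))

/-- Forgetting the shift of the digits is Hölder continuous with exponent `s` if the products of
the bases satisfy `P ^ s ≤ C * P'`. -/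
theorem IsDigitWindow.abs_sub_le {q a M : ℕ → ℕ} (h : IsDigitWindow q a M)
    (hq : IsBasicSequence q) {s C : ℝ} (hs1 : s ≤ 1) (hs0 : 0 < s)
    (hC : ∀ n, (cantorProd q n : ℝ) ^ s ≤ C * cantorProd M n)
    {x x' y y' : ℝ} (hx : x ∈ Set.Ico (0 : ℝ) 1) (hx' : x' ∈ Set.Ico (0 : ℝ) 1)
    (hy : y ∈ Set.Ico (0 : ℝ) 1) (hy' : y' ∈ Set.Ico (0 : ℝ) 1)
    (hs : IsDigitShift q a M y x) (hs' : IsDigitShift q a M y' x') :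
    |y - y'| ≤ 6 * C * |x - x'| ^ s := by
  have hlevel := h.cantorProd_mul_abs_sub_le hx hx' hy hy' hs hs'
  have hCpos := pos_of_cantorProd_rpow_le hC
  obtain hr | hr := (abs_nonneg (x - x')).eq_or_lt
  · -- equal `x` force `y - y'` to be at most twice any cylinder length of base `M`
    rw [← hr, Real.zero_rpow hs0.ne', mul_zero]
    by_contra! hpos
    obtain ⟨n, hn⟩ := ((hq.tendsto_cantorProd_rpow hs0).eventually_gt_atTop
      (C * (2 / |y - y'|))).exists
    have h1 := hlevel n
    rw [← hr, mul_zero, zero_add, ← le_div_iff₀ hpos] at h1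
    have := mul_le_mul_of_nonneg_left h1 hCpos.le
    linarith [hC n]
  · set r := |x - x'| with hrdef
    have hr1 : r < 1 := by
      rw [hrdef, abs_lt]; constructor <;> linarith [hx.1, hx.2, hx'.1, hx'.2]
    -- `n + 1` is the first level at which the cylinders have length at most `r`
    obtain ⟨n, hn1, hn2⟩ :
        ∃ n, (cantorProd q n : ℝ) * r < 1 ∧ 1 ≤ (cantorProd q (n + 1) : ℝ) * r := by
      have hex : ∃ n, 1 ≤ (cantorProd q n : ℝ) * r := by
        obtain ⟨n, hn⟩ := pow_unbounded_of_one_lt (1 / r) (one_lt_two)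
        refine ⟨n, ?_⟩
        rw [← div_le_iff₀ hr]
        exact hn.le.trans (by exact_mod_cast hq.two_pow_le n)
      classical
      have h0 : Nat.find hex ≠ 0 := by
        intro h0
        have := (Nat.find_eq_zero hex).mp h0
        simp [cantorProd] at this
        linarith
      obtain ⟨n, hn⟩ := Nat.exists_eq_succ_of_ne_zero h0
      refine ⟨n, not_le.mp (Nat.find_min hex (by omega)), ?_⟩
      have := Nat.find_spec hex
      rwa [hn] at this
    have hPn := hq.cantorProd_pos n
    have hMn := cantorProd_pos_of_pos h.pos n
    have hMpos : (0 : ℝ) < M (n + 1) := by exact_mod_cast h.pos (n + 1) (by omega)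
    have h2M : (q (n + 1) : ℝ) ≤ 2 * M (n + 1) := by exact_mod_cast h.le_two_mul (n + 1) (by omega)
    have hl := hlevel (n + 1)
    have h3 : (cantorProd M (n + 1) : ℝ) * |y - y'| ≤ 3 * (cantorProd q (n + 1) * r) := by
      linarith
    rw [cantorProd_succ, cantorProd_succ] at h3
    push_cast at h3
    have h4 : (cantorProd M n : ℝ) * |y - y'| ≤ 6 * (cantorProd q n * r) := by
      refine le_of_mul_le_mul_right ?_ hMpos
      nlinarith [mul_pos hPn hr]
    -- `P * r ≤ (P * r) ^ s` as `P * r < 1`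
    have h5 : (cantorProd q n : ℝ) * r ≤ (cantorProd q n : ℝ) ^ s * r ^ s := by
      rw [← Real.mul_rpow hPn.le hr.le]
      simpa using Real.rpow_le_rpow_of_exponent_ge (mul_pos hPn hr) hn1.le hs1
    have h6 : (0 : ℝ) < r ^ s := Real.rpow_pos_of_pos hr s
    refine le_of_mul_le_mul_left ?_ hMn
    nlinarith [mul_le_mul_of_nonneg_right (hC n) h6.le]

/-- The transfer of Hausdorff dimension: a set of numbers with digits in the windows is at least
`s` times as large as the set of numbers obtained from it by shifting the digits back. -/
theorem IsDigitWindow.mul_dimH_le {q a M : ℕ → ℕ} (h : IsDigitWindow q a M)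
    (hq : IsBasicSequence q) {s : NNReal} {C : ℝ} (hs0 : 0 < s) (hs1 : s ≤ 1)
    (hC : ∀ n, (cantorProd q n : ℝ) ^ (s : ℝ) ≤ C * cantorProd M n)
    {Y A : Set ℝ} (hY : Y ⊆ Set.Ico 0 1) (hA : ∀ y ∈ Y, ∀ x, IsDigitShift q a M y x → x ∈ A) :
    s * dimH Y ≤ dimH A := by
  have hs0' : (0 : ℝ) < s := hs0
  have hCpos := pos_of_cantorProd_rpow_le hC
  have hlim : Tendsto (fun n => (cantorProd M n : ℝ)) atTop atTop :=
    (tendsto_const_mul_atTop_of_pos hCpos).mp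
      (tendsto_atTop_mono hC (hq.tendsto_cantorProd_rpow hs0'))
  choose Φ hΦ hshift using h.exists_isDigitShift hq hlim
  have hest : ∀ y ∈ Y, ∀ y' ∈ Y, |y - y'| ≤ 6 * C * |Φ y - Φ y'| ^ (s : ℝ) := fun y hy y' hy' =>
    h.abs_sub_le hq (by exact_mod_cast hs1) hs0' hC (hΦ y) (hΦ y') (hY hy) (hY hy')
      (hshift y) (hshift y')
  have hinj : Set.InjOn Φ Y := fun y hy y' hy' he => by
    have := hest y hy y' hy'
    rw [he, sub_self, abs_zero, Real.zero_rpow hs0'.ne', mul_zero] at this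
    exact sub_eq_zero.mp (abs_nonpos_iff.mp this)
  have hinv := hinj.leftInvOn_invFunOn
  have hhol : HolderOnWith (6 * C).toNNReal s (Function.invFunOn Φ Y) (Φ '' Y) := by
    rintro _ ⟨y, hy, rfl⟩ _ ⟨y', hy', rfl⟩
    rw [hinv hy, hinv hy', edist_dist, edist_dist, Real.dist_eq, Real.dist_eq,
      ENNReal.ofReal_rpow_of_nonneg (abs_nonneg _) hs0'.le]
    change _ ≤ ENNReal.ofReal _ * _
    rw [← ENNReal.ofReal_mul (by positivity)]
    exact ENNReal.ofReal_le_ofReal (hest y hy y' hy')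
  have hdim := hhol.dimH_image_le hs0
  rw [hinv.image_image, ENNReal.le_div_iff_mul_le (by simp [hs0.ne']) (by simp)] at hdim
  rw [mul_comm]
  refine hdim.trans (dimH_mono ?_)
  rintro _ ⟨y, hy, rfl⟩
  exact hA y hy _ (hshift y)

theorem dimH_eq_one_of_forall_lt {A : Set ℝ}
    (h : ∀ s : NNReal, 0 < s → s < 1 → (s : ENNReal) ≤ dimH A) : dimH A = 1 := by
  refine le_antisymm ((dimH_mono (Set.subset_univ A)).trans Real.dimH_univ.le) ?_
  refine ENNReal.le_of_forall_nnreal_lt fun s hs => ?_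
  obtain rfl | hpos := eq_zero_or_pos s
  · simp
  · exact h s hpos (by exact_mod_cast hs)

/-! ### The average number of zero digits -/

theorem measurable_cantorDigit (M : ℕ → ℕ) (j : ℕ) : Measurable fun y => cantorDigit M y j :=
  ((measurable_fract.comp (measurable_const_mul _)).const_mul _).nat_floor

theorem volume_Ico_inter_cantorDigit_eq_zero_le {M : ℕ → ℕ} (hM : ∀ j, 1 ≤ j → 1 ≤ M j) {j : ℕ}
    (hj : 1 ≤ j) :
    MeasureTheory.volume ({y : ℝ | cantorDigit M y j = 0} ∩ Set.Ico 0 1)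
      ≤ ENNReal.ofReal (1 / M j) := by
  set L := cantorProd M (j - 1) with hL
  have hLpos : (0 : ℝ) < L := cantorProd_pos_of_pos hM _
  have hMpos : (0 : ℝ) < M j := by exact_mod_cast hM j hj
  -- the digit vanishes exactly on the first `1 / M j` of each cylinder `[i / L, (i + 1) / L)`
  have hsub : {y : ℝ | cantorDigit M y j = 0} ∩ Set.Ico 0 1
      ⊆ ⋃ i ∈ Finset.range L, Set.Ico ((i : ℝ) / L) (i / L + 1 / M j / L) := by
    rintro y ⟨hy, hy0, hy1⟩
    have h1 : (M j : ℝ) * Int.fract ((L : ℝ) * y) < 1 := Nat.floor_eq_zero.mp hy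
    rw [mul_comm, ← lt_div_iff₀ hMpos] at h1
    have h2 : 0 ≤ (L : ℝ) * y := by positivity
    have h3 : ((⌊(L : ℝ) * y⌋₊ : ℕ) : ℝ) + Int.fract ((L : ℝ) * y) = L * y := by
      rw [natCast_floor_eq_intCast_floor h2, Int.floor_add_fract]
    have h4 := Int.fract_nonneg ((L : ℝ) * y)
    simp only [Set.mem_iUnion, Finset.mem_range]
    refine ⟨⌊(L : ℝ) * y⌋₊, (Nat.floor_lt h2).mpr (by nlinarith), ?_, ?_⟩
    · rw [div_le_iff₀ hLpos]; linarith
    · rw [← add_div, lt_div_iff₀ hLpos]; linarith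
  calc MeasureTheory.volume ({y : ℝ | cantorDigit M y j = 0} ∩ Set.Ico 0 1)
      ≤ ∑ i ∈ Finset.range L,
          MeasureTheory.volume (Set.Ico ((i : ℝ) / L) (i / L + 1 / M j / L)) :=
        (MeasureTheory.measure_mono hsub).trans (MeasureTheory.measure_biUnion_finset_le _ _)
    _ = ENNReal.ofReal (1 / M j) := by
        simp only [Real.volume_Ico, add_sub_cancel_left, Finset.sum_const, Finset.card_range,
          nsmul_eq_mul]
        rw [← ENNReal.ofReal_natCast, ← ENNReal.ofReal_mul hLpos.le]
        congr 1
        field_simp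

/-- If the expected number of zero digits at positions with property `p` falls short of `Q n` by a
constant factor for infinitely many `n`, then it is not true that the quotient of the actual
number and `Q n` tends to `1` almost everywhere, by Fatou's lemma. -/
theorem volume_not_tendsto_count_zero_ne_zero {M : ℕ → ℕ} (hM : ∀ j, 1 ≤ j → 1 ≤ M j)
    (p : ℕ → Prop) [DecidablePred p] (Q : ℕ → ℝ) {c : ℝ} (hc : c < 1)
    (hQ : ∀ n, 1 ≤ n → 0 < Q n)
    (hfreq : ∃ᶠ n in atTop, ∑ j ∈ Finset.Icc 1 n with p j, 1 / (M j : ℝ) ≤ c * Q n) :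
    MeasureTheory.volume {y ∈ Set.Ico (0 : ℝ) 1 | ¬ Tendsto (fun n =>
      (((Finset.Icc 1 n).filter fun j => p j ∧ cantorDigit M y j = 0).card : ℝ) / Q n)
        atTop (𝓝 1)} ≠ 0 := by
  intro hzero
  set μ := MeasureTheory.volume.restrict (Set.Ico (0 : ℝ) 1) with hμ
  set f : ℕ → ℝ → ENNReal := fun n y => ENNReal.ofReal (1 / Q n) *
    ∑ j ∈ Finset.Icc 1 n with p j, {y : ℝ | cantorDigit M y j = 0}.indicator 1 y with hf
  have hset : ∀ j, MeasurableSet {y : ℝ | cantorDigit M y j = 0} := fun j =>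
    measurable_cantorDigit M j (measurableSet_singleton 0)
  have hmeas : ∀ n, Measurable (f n) := fun n =>
    (Finset.measurable_fun_sum _ fun j _ => measurable_one.indicator (hset j)).const_mul _
  have hfeq : ∀ n, 1 ≤ n → ∀ y, f n y = ENNReal.ofReal
      ((((Finset.Icc 1 n).filter fun j => p j ∧ cantorDigit M y j = 0).card : ℝ) / Q n) := by
    intro n hn y
    have h1 : ∑ j ∈ Finset.Icc 1 n with p j,
        {y : ℝ | cantorDigit M y j = 0}.indicator (1 : ℝ → ENNReal) y
        = (((Finset.Icc 1 n).filter fun j => p j ∧ cantorDigit M y j = 0).card : ENNReal) := by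
      rw [← Finset.filter_filter, Finset.card_filter]
      push_cast
      exact Finset.sum_congr rfl fun j _ => by simp [Set.indicator_apply]
    have h2 := hQ n hn
    rw [hf]
    dsimp only
    rw [h1, ← ENNReal.ofReal_natCast, ← ENNReal.ofReal_mul (by positivity)]
    congr 1
    ring
  have hlim : ∀ᵐ y ∂μ, liminf (fun n => f n y) atTop = 1 := by
    rw [hμ, MeasureTheory.ae_restrict_iff' measurableSet_Ico, MeasureTheory.ae_iff]
    refine MeasureTheory.measure_mono_null (fun y hy => ?_) hzero
    simp only [Set.mem_ofPred_eq, Classical.not_imp] at hy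
    refine ⟨hy.1, fun ht => hy.2 (Tendsto.liminf_eq ?_)⟩
    have h1 := (ENNReal.continuous_ofReal.tendsto 1).comp ht
    rw [ENNReal.ofReal_one] at h1
    exact h1.congr' ((eventually_ge_atTop 1).mono fun n hn => (hfeq n hn y).symm)
  have hint : ∀ n, 1 ≤ n → ∑ j ∈ Finset.Icc 1 n with p j, 1 / (M j : ℝ) ≤ c * Q n →
      ∫⁻ y, f n y ∂μ ≤ ENNReal.ofReal c := by
    intro n hn hle
    have hQn := hQ n hn
    rw [MeasureTheory.lintegral_const_mul _
      (Finset.measurable_fun_sum _ fun j _ => measurable_one.indicator (hset j)),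
      MeasureTheory.lintegral_finsetSum _ fun j _ => measurable_one.indicator (hset j)]
    calc _ ≤ ENNReal.ofReal (1 / Q n)
          * ∑ j ∈ Finset.Icc 1 n with p j, ENNReal.ofReal (1 / (M j : ℝ)) := by
          gcongr with j hj
          rw [MeasureTheory.lintegral_indicator_one (hset j), hμ,
            MeasureTheory.Measure.restrict_apply (hset j)]
          exact volume_Ico_inter_cantorDigit_eq_zero_le hM
            (Finset.mem_Icc.mp (Finset.mem_filter.mp hj).1).1
      _ = ENNReal.ofReal (1 / Q n * ∑ j ∈ Finset.Icc 1 n with p j, 1 / (M j : ℝ)) := by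
          rw [← ENNReal.ofReal_sum_of_nonneg fun j _ => by positivity,
            ← ENNReal.ofReal_mul (by positivity)]
      _ ≤ ENNReal.ofReal c := by
          refine ENNReal.ofReal_le_ofReal ?_
          rw [one_div, inv_mul_le_iff₀ hQn, mul_comm]
          exact hle
  have h1 : (1 : ENNReal) ≤ ENNReal.ofReal c := calc
    (1 : ENNReal) = ∫⁻ y, liminf (fun n => f n y) atTop ∂μ := by
        rw [MeasureTheory.lintegral_congr_ae hlim]; simp [hμ]
    _ ≤ liminf (fun n => ∫⁻ y, f n y ∂μ) atTop := MeasureTheory.lintegral_liminf_le hmeas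
    _ ≤ ENNReal.ofReal c := liminf_le_of_frequently_le'
        ((hfreq.and_eventually (eventually_ge_atTop 1)).mono fun n hn => hint n hn.2 hn.1)
  rw [ENNReal.one_le_ofReal] at h1
  linarith

/-- Some residue class modulo `k` carries, for infinitely many `n`, a fixed proportion of the
partial sums of a positive sequence. -/
theorem exists_residue_frequently_le (w : ℕ → ℝ) (hw : ∀ j, 1 ≤ j → 0 < w j) {k : ℕ}
    (hk : 1 ≤ k) : ∃ r, ∃ᶠ n in atTop,
      (∑ j ∈ Finset.Icc 1 n, w j) / (2 * k) ≤ ∑ j ∈ Finset.Icc 1 n with j % k = r, w j := by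
  by_contra! hcon
  have hall : ∀ᶠ n in atTop, ∀ r ∈ Finset.range k,
      ∑ j ∈ Finset.Icc 1 n with j % k = r, w j < (∑ j ∈ Finset.Icc 1 n, w j) / (2 * k) :=
    (Finset.eventually_all _).mpr fun r _ =>
      hcon r
  obtain ⟨n, hn, hn1⟩ := (hall.and (eventually_ge_atTop 1)).exists
  have hpos : 0 < ∑ j ∈ Finset.Icc 1 n, w j :=
    Finset.sum_pos (fun j hj => hw j (Finset.mem_Icc.mp hj).1) ⟨1, by simpa using hn1⟩
  have h1 := Finset.sum_fiberwise_of_maps_to (s := Finset.Icc 1 n) (t := Finset.range k)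
    (g := fun j => j % k) (fun j _ => Finset.mem_range.mpr (Nat.mod_lt j hk)) w
  have h2 := Finset.sum_le_sum fun r hr => (hn r hr).le
  rw [h1, Finset.sum_const, Finset.card_range, nsmul_eq_mul] at h2
  have hk' : (0 : ℝ) < k := by exact_mod_cast hk
  have h3 : (k : ℝ) * ((∑ j ∈ Finset.Icc 1 n, w j) / (2 * k))
      = (∑ j ∈ Finset.Icc 1 n, w j) / 2 := by
    field_simp
  linarith

theorem one_le_dimH_of_volume_ne_zero {Y : Set ℝ} (h : MeasureTheory.volume Y ≠ 0) :
    1 ≤ dimH Y := by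
  rw [← MeasureTheory.hausdorffMeasure_real] at h
  exact_mod_cast le_dimH_of_hausdorffMeasure_ne_zero (d := 1) (by simpa using h)

/-! ### The cost of the restrictions -/

theorem exists_two_pow_le_rpow {q : ℕ → ℕ} (hq : IsBasicSequence q) (hinf : IsInfiniteInLimit q)
    {ε : ℝ} (hε : 0 < ε) : ∃ C : ℝ, ∀ n, (2 : ℝ) ^ n ≤ C * (cantorProd q n : ℝ) ^ ε := by
  obtain ⟨N, hN⟩ := eventually_atTop.mp (((tendsto_rpow_atTop hε).comp
    (tendsto_natCast_atTop_atTop.comp hinf)).eventually_ge_atTop 2)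
  refine ⟨2 ^ N, fun n => ?_⟩
  have h1 : (1 : ℝ) ≤ (cantorProd q n : ℝ) ^ ε := Real.one_le_rpow
    (by exact_mod_cast Nat.one_le_two_pow.trans (hq.two_pow_le n)) hε.le
  induction n with
  | zero =>
    rw [pow_zero]
    exact one_le_mul_of_one_le_of_one_le (one_le_pow₀ one_le_two) h1
  | succ n ih =>
    obtain hle | hlt := Nat.lt_or_ge N (n + 1)
    · have h2 : (2 : ℝ) ≤ (q (n + 1) : ℝ) ^ ε := hN (n + 1) hle.le
      have h3 := ih (Real.one_le_rpow
        (by exact_mod_cast Nat.one_le_two_pow.trans (hq.two_pow_le n)) hε.le)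
      rw [cantorProd_succ, Nat.cast_mul, Real.mul_rpow (by positivity) (by positivity), pow_succ,
        ← mul_assoc]
      gcongr
    · exact (pow_le_pow_right₀ one_le_two hlt).trans
        (le_mul_of_one_le_right (by positivity) h1)

/-- Restricting the digits at the positions with property `p` to windows costs a factor `2` for
each of these positions. -/
theorem cantorProd_le_two_pow_mul {q M : ℕ → ℕ} {p : ℕ → Prop} [DecidablePred p]
    (h2 : ∀ j, 1 ≤ j → q j ≤ 2 * M j) (hp : ∀ j, ¬ p j → M j = q j) (n : ℕ) :
    cantorProd q n ≤ 2 ^ ((Finset.Icc 1 n).filter p).card * cantorProd M n := by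
  induction n with
  | zero => simp [cantorProd]
  | succ n ih =>
    rw [cantorProd_succ, cantorProd_succ, ← Finset.insert_Icc_right_eq_Icc_add_one (by omega),
      Finset.filter_insert]
    split_ifs with hpn
    · rw [Finset.card_insert_of_notMem (by simp), pow_succ]
      calc _ ≤ _ := Nat.mul_le_mul ih (h2 (n + 1) (by omega))
        _ = _ := by ring
    · rw [hp _ hpn, ← mul_assoc]
      exact Nat.mul_le_mul_right _ ih

theorem mul_card_filter_mod_le (k r n : ℕ) :
    k * ((Finset.Icc 1 n).filter fun j => j % k = r).card ≤ n + k := by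
  have h1 : ((Finset.Icc 1 n).filter fun j => j % k = r).card ≤ (Finset.range (n / k + 1)).card := by
    refine Finset.card_le_card_of_injOn (fun j => j / k) (fun j hj => ?_) fun i hi j hj hij => ?_
    · have hj' := (Finset.mem_Icc.mp (Finset.mem_filter.mp hj).1).2
      exact Finset.mem_coe.mpr (Finset.mem_range.mpr
        (Nat.lt_succ_of_le (Nat.div_le_div_right hj')))
    · have hi' := (Finset.mem_filter.mp hi).2
      have hj' := (Finset.mem_filter.mp hj).2
      dsimp only at hij
      rw [← Nat.div_add_mod i k, ← Nat.div_add_mod j k, hi', hj', hij]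
  rw [Finset.card_range] at h1
  calc _ ≤ k * (n / k + 1) := Nat.mul_le_mul_left k h1
    _ ≤ n + k := by rw [mul_add, mul_one]; exact Nat.add_le_add_right (Nat.mul_div_le n k) k

theorem rpow_le_mul_of_le_mul {P P' D C s : ℝ} (hP : 0 < P) (hP' : 0 ≤ P') (h : P ≤ D * P')
    (hD : D ≤ C * P ^ (1 - s)) : P ^ s ≤ C * P' := by
  have h1 : 0 < P ^ (1 - s) := Real.rpow_pos_of_pos hP _
  refine le_of_mul_le_mul_right ?_ h1
  rw [← Real.rpow_add hP, add_sub_cancel, Real.rpow_one]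
  calc P ≤ D * P' := h
    _ ≤ C * P ^ (1 - s) * P' := by gcongr
    _ = C * P' * P ^ (1 - s) := by ring

/-- Restrictions at positions in one residue class modulo `k` decrease the dimension by at most
`1 / k`. -/
theorem cantorProd_rpow_le_of_residue {q M : ℕ → ℕ} (hq : IsBasicSequence q)
    (h2 : ∀ j, 1 ≤ j → q j ≤ 2 * M j) {k r : ℕ} (hk : 1 ≤ k)
    (hM : ∀ j, j % k ≠ r → M j = q j) {s : ℝ} (hs : 1 / (k : ℝ) ≤ 1 - s) (n : ℕ) :
    (cantorProd q n : ℝ) ^ s ≤ 2 * cantorProd M n := by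
  have hk' : (0 : ℝ) < k := by exact_mod_cast hk
  set c := ((Finset.Icc 1 n).filter fun j => j % k = r).card with hc
  have h1 : (1 : ℝ) ≤ cantorProd q n := by
    exact_mod_cast Nat.one_le_two_pow.trans (hq.two_pow_le n)
  refine rpow_le_mul_of_le_mul (D := 2 ^ c) (by linarith) (Nat.cast_nonneg _)
    (by exact_mod_cast cantorProd_le_two_pow_mul h2 hM n) ?_
  have h3 : ((2 : ℝ) ^ c) ^ k ≤ (2 * (cantorProd q n : ℝ) ^ (1 / (k : ℝ))) ^ k := by
    rw [mul_pow, ← Real.rpow_natCast (_ ^ (1 / (k : ℝ))), ← Real.rpow_mul (by linarith),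
      one_div_mul_cancel hk'.ne', Real.rpow_one, ← pow_mul, mul_comm c k]
    calc (2 : ℝ) ^ (k * c) ≤ 2 ^ (n + k) :=
          pow_le_pow_right₀ one_le_two (mul_card_filter_mod_le k r n)
      _ = 2 ^ k * 2 ^ n := by ring
      _ ≤ 2 ^ k * cantorProd q n := by gcongr; exact_mod_cast hq.two_pow_le n
  calc (2 : ℝ) ^ c ≤ 2 * (cantorProd q n : ℝ) ^ (1 / (k : ℝ)) :=
        le_of_pow_le_pow_left₀ (by omega) (by positivity) h3
    _ ≤ 2 * (cantorProd q n : ℝ) ^ (1 - s) := by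
        gcongr

/-! ### Failure of normality -/

theorem not_isUniformlyDistributedModOne {X : ℕ → ℝ}
    (h : ∀ᶠ n in atTop, Int.fract (X n) < 3 / 4) : ¬ IsUniformlyDistributedModOne X := by
  intro hX
  have h1 := hX (3 / 4) (7 / 8) (by norm_num) (by norm_num) (by norm_num)
  obtain ⟨N, hN⟩ := eventually_atTop.mp h
  have hbound : ∀ n, (fractCount (Set.Icc (3 / 4) (7 / 8)) X n : ℝ) ≤ N := by
    intro n
    have : fractCount (Set.Icc (3 / 4) (7 / 8)) X n ≤ (Finset.range N).card := by
      refine Finset.card_le_card fun j hj => ?_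
      replace hj := (@Finset.mem_filter _ _ (_) _ _).mp hj
      by_contra hcon
      have := hN j (not_lt.mp (mt Finset.mem_range.mpr hcon))
      linarith [hj.2.1]
    rw [Finset.card_range] at this
    exact_mod_cast this
  have h0 : Tendsto (fun n => (fractCount (Set.Icc (3 / 4) (7 / 8)) X n : ℝ) / (n : ℝ))
      atTop (𝓝 0) :=
    squeeze_zero (fun n => by positivity)
      (fun n => div_le_div_of_nonneg_right (hbound n) (Nat.cast_nonneg n))
      (tendsto_const_div_atTop_nhds_zero_nat (N : ℝ))
  have := tendsto_nhds_unique h0 h1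
  norm_num at this

theorem cantorT_mul_lt (q : ℕ → ℕ) (x : ℝ) (n : ℕ) :
    q (n + 1) * cantorT q n x < cantorDigit q x (n + 1) + 1 := by
  have h := natCast_cantorDigit q x n
  have h1 : cantorT q (n + 1) x < 1 := Int.fract_lt_one _
  linarith

theorem blockCount_zero_eq_zero {q : ℕ → ℕ} {x : ℝ} (h : ∀ j, 1 ≤ j → cantorDigit q x j ≠ 0)
    {k : ℕ} (hk : 0 < k) (n : ℕ) : blockCount q (fun _ : Fin k => 0) n x = 0 := by
  refine Finset.card_eq_zero.mpr (Finset.filter_eq_empty_iff.mpr fun j hj hcon => ?_)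
  exact h j (Finset.mem_Icc.mp hj).1 (by simpa using hcon ⟨0, hk⟩)

/-- If `q n → ∞`, the numbers whose digits all avoid `0` and lie in the lower half form a set of
dimension `1`: halving every set of digits costs a factor `2 ^ n`, which is smaller than any power
of `q 1 * ... * q n`. -/
theorem dimH_eq_one_of_isInfiniteInLimit {q : ℕ → ℕ} (hq : IsBasicSequence q)
    (hinf : IsInfiniteInLimit q) {A : Set ℝ}
    (hA : ∀ x, (∀ j, 1 ≤ j → 1 ≤ cantorDigit q x j ∧ cantorDigit q x j ≤ (q j + 1) / 2) → x ∈ A) :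
    dimH A = 1 := by
  refine dimH_eq_one_of_forall_lt fun s hs0 hs1 => ?_
  have hw : IsDigitWindow q (fun _ => 1) (fun j => (q j + 1) / 2) := by
    constructor <;> intro j hj <;> have := hq j hj <;> omega
  have hs1' : (s : ℝ) < 1 := hs1
  obtain ⟨C, hC⟩ := exists_two_pow_le_rpow hq hinf (sub_pos.mpr hs1')
  have hcost : ∀ n, (cantorProd q n : ℝ) ^ (s : ℝ)
      ≤ C * cantorProd (fun j => (q j + 1) / 2) n := fun n => by
    have h1 := cantorProd_le_two_pow_mul (p := fun _ => True) hw.le_two_mul (by simp) n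
    rw [Finset.filter_true, Nat.card_Icc, Nat.add_sub_cancel] at h1
    exact rpow_le_mul_of_le_mul (hq.cantorProd_pos n) (Nat.cast_nonneg _)
      (by exact_mod_cast h1) (hC n)
  have h1 := hw.mul_dimH_le hq hs0 hs1.le hcost (Y := Set.Ico 0 1) (A := A) subset_rfl
    fun y _ x hx => hA x fun j hj => by
      have h1 : cantorDigit q x j = 1 + cantorDigit (fun j => (q j + 1) / 2) y j := hx j hj
      have h2 : cantorDigit (fun j => (q j + 1) / 2) y j < (q j + 1) / 2 :=
        cantorDigit_lt_of_pos y (hw.pos j hj)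
      omega
  refine le_trans ?_ h1
  exact le_mul_of_one_le_right' (one_le_dimH_of_volume_ne_zero (by simp))

/-- Halving the digits only at positions `≡ 1` modulo `k` costs a factor of about `2 ^ (n / k)`,
and keeps the remainders `T_{Q,kn+k}(x)` away from `1`. -/
theorem dimH_not_isStronglyQDistributionNormal {q : ℕ → ℕ} (hq : IsBasicSequence q) :
    dimH {x : ℝ | ¬ IsStronglyQDistributionNormal q x} = 1 := by
  refine dimH_eq_one_of_forall_lt fun s hs0 hs1 => ?_
  have hs1' : (s : ℝ) < 1 := hs1
  obtain ⟨m, hm⟩ := exists_nat_one_div_lt (sub_pos.mpr hs1')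
  set k := m + 1 with hk
  set M : ℕ → ℕ := fun j => if j % k = 1 % k then (q j + 1) / 2 else q j with hM
  have hw : IsDigitWindow q (fun _ => 0) M := by
    constructor <;> intro j hj <;> have := hq j hj <;> simp only [hM] <;> split_ifs <;> omega
  have hcost : ∀ n, (cantorProd q n : ℝ) ^ (s : ℝ) ≤ 2 * cantorProd M n :=
    cantorProd_rpow_le_of_residue hq hw.le_two_mul (by omega : 1 ≤ k)
      (r := 1 % k) (fun j hj => by simp only [hM, if_neg hj]) (by rw [hk]; push_cast; exact hm.le)
  refine (le_mul_of_one_le_right' (one_le_dimH_of_volume_ne_zero (by simp))).trans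
    (hw.mul_dimH_le hq hs0 hs1.le hcost (Y := Set.Ico 0 1) subset_rfl fun y _ x hx => ?_)
  intro hnormal
  refine not_isUniformlyDistributedModOne (Eventually.of_forall fun n => ?_)
    (hnormal k k (by omega) (by omega) le_rfl)
  -- the remainder at `k * n + k` starts with a digit in the lower half
  have h1 : cantorDigit q x (k * n + k + 1) = 0 + cantorDigit M y (k * n + k + 1) :=
    hx _ (by omega)
  have h2 := cantorDigit_lt_of_pos y (hw.pos (k * n + k + 1) (by omega))
  have h3 : (k * n + k + 1) % k = 1 % k := by
    rw [show k * n + k + 1 = 1 + k * (n + 1) by ring, Nat.add_mul_mod_self_left]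
  have h7 : M (k * n + k + 1) = (q (k * n + k + 1) + 1) / 2 := if_pos h3
  have h4 := hq (k * n + k + 1) (by omega)
  have h5 : 3 * (cantorDigit q x (k * n + k + 1) + 1) ≤ 2 * q (k * n + k + 1) := by omega
  have h5' : 3 * ((cantorDigit q x (k * n + k + 1) : ℝ) + 1) ≤ 2 * q (k * n + k + 1) := by
    exact_mod_cast h5
  have h6 := cantorT_mul_lt q x (k * n + k)
  have h4' : (2 : ℝ) ≤ q (k * n + k + 1) := by exact_mod_cast h4
  change Int.fract (Int.fract _) < _
  rw [Int.fract_fract]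
  change cantorT q (k * n + k) x < _
  nlinarith

/-- The digit `0` is forbidden at the positions in a residue class modulo `k` which carries a fixed
proportion of `Q_n^{(1)}` for infinitely many `n`; this lowers the expected number of zeros by the same proportion. -/
theorem dimH_not_isSimplyQNormal {q : ℕ → ℕ} (hq : IsBasicSequence q) :
    dimH {x : ℝ | ¬ IsSimplyQNormal q x} = 1 := by
  refine dimH_eq_one_of_forall_lt fun s hs0 hs1 => ?_
  have hs1' : (s : ℝ) < 1 := hs1
  obtain ⟨m, hm⟩ := exists_nat_one_div_lt (sub_pos.mpr hs1')
  set k := m + 1 with hk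
  have hk' : (0 : ℝ) < k := by positivity
  have hqpos : ∀ j, 1 ≤ j → 0 < 1 / (q j : ℝ) := fun j hj => by
    have : (2 : ℝ) ≤ q j := by exact_mod_cast hq j hj
    positivity
  obtain ⟨r, hr⟩ := exists_residue_frequently_le (fun j => 1 / (q j : ℝ)) hqpos
    (by omega : 1 ≤ k)
  set a : ℕ → ℕ := fun j => if j % k = r then 1 else 0 with ha
  set M : ℕ → ℕ := fun j => q j - a j with hM
  have hw : IsDigitWindow q a M := by
    constructor <;> intro j hj <;> have := hq j hj <;> simp only [hM, ha] <;> split_ifs <;> omega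
  have hMeq : ∀ j, j % k ≠ r → M j = q j := fun j hj => by simp [hM, ha, hj]
  have hcost : ∀ n, (cantorProd q n : ℝ) ^ (s : ℝ) ≤ 2 * cantorProd M n :=
    cantorProd_rpow_le_of_residue hq hw.le_two_mul (by omega : 1 ≤ k) hMeq
      (by rw [hk]; push_cast; exact hm.le)
  have hmean : ∀ n, blockMean q 1 n = ∑ j ∈ Finset.Icc 1 n, 1 / (q j : ℝ) := fun n => by
    simp [blockMean]
  have hY := volume_not_tendsto_count_zero_ne_zero hw.pos (fun j => j % k ≠ r) (blockMean q 1)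
    (c := 1 - 1 / (2 * k)) (by linarith [show 0 < 1 / (2 * (k : ℝ)) by positivity])
    (fun n hn => by
      rw [hmean]
      exact Finset.sum_pos (fun j hj => hqpos j (Finset.mem_Icc.mp hj).1) ⟨1, by simpa using hn⟩)
    (hr.mono fun n hn => by
      have h1 := Finset.sum_filter_add_sum_filter_not (Finset.Icc 1 n) (fun j => j % k = r)
        fun j => 1 / (q j : ℝ)
      have h2 : ∑ j ∈ Finset.Icc 1 n with j % k ≠ r, 1 / (M j : ℝ)
          = ∑ j ∈ Finset.Icc 1 n with ¬ j % k = r, 1 / (q j : ℝ) :=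
        Finset.sum_congr rfl fun j hj => by rw [hMeq j (Finset.mem_filter.mp hj).2]
      rw [h2, hmean, sub_mul, one_mul, one_div_mul_eq_div]
      linarith)
  refine (le_mul_of_one_le_right' (one_le_dimH_of_volume_ne_zero hY)).trans
    (hw.mul_dimH_le hq hs0 hs1.le hcost (fun y hy => hy.1) fun y hy x hx => ?_)
  intro hnormal
  refine hy.2 ((hnormal fun _ => 0).congr fun n => ?_)
  congr 2
  refine congrArg Finset.card (Finset.filter_congr fun j hj => ?_)
  have h1 := hx j (Finset.mem_Icc.mp hj).1
  simp only [Fin.forall_fin_one, Fin.val_zero, add_zero, h1, ha]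
  split_ifs with h <;> simp [h]

theorem mainTheorem5 (q : ℕ → ℕ) (hq : IsBasicSequence q) :
    (IsInfiniteInLimit q →
      dimH {x : ℝ | ¬ IsQRatioNormalOfOrder q 2 x} = 1 ∧
      dimH {x : ℝ | ¬ IsQDistributionNormal q x} = 1 ∧
      dimH {x : ℝ | ¬ IsQNormalOfOrder q 2 x} = 1) ∧
    (IsKDivergent q 1 → dimH {x : ℝ | ¬ IsSimplyQNormal q x} = 1) ∧
    dimH {x : ℝ | ¬ IsStronglyQDistributionNormal q x} = 1 := by
  refine ⟨fun hinf => ⟨?_, ?_, ?_⟩, fun _ => dimH_not_isSimplyQNormal hq,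
    dimH_not_isStronglyQDistributionNormal hq⟩
  · refine dimH_eq_one_of_isInfiniteInLimit hq hinf fun x hx hnormal => ?_
    -- the block `(0, 0)` never occurs, so its quotient by any other count is identically `0`
    have h1 := hnormal (fun _ => 0) (fun _ => 1)
    simp only [blockCount_zero_eq_zero (fun j hj => (Nat.one_le_iff_ne_zero.mp (hx j hj).1))
      two_pos, Nat.cast_zero, zero_div] at h1
    exact zero_ne_one (tendsto_nhds_unique tendsto_const_nhds h1)
  · refine dimH_eq_one_of_isInfiniteInLimit hq hinf fun x hx => ?_
    refine not_isUniformlyDistributedModOne ?_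
    -- the remainder at `n` is at most `((q (n + 1) + 1) / 2 + 1) / q (n + 1)`
    filter_upwards [((tendsto_add_atTop_iff_nat 1).mpr hinf).eventually_ge_atTop 6] with n hn
    have h1 := (hx (n + 1) (by omega)).2
    have h2 : 4 * (cantorDigit q x (n + 1) + 1) ≤ 3 * q (n + 1) := by omega
    have h2' : 4 * ((cantorDigit q x (n + 1) : ℝ) + 1) ≤ 3 * q (n + 1) := by exact_mod_cast h2
    have h3 := cantorT_mul_lt q x n
    have h4 : (6 : ℝ) ≤ q (n + 1) := by exact_mod_cast hn
    change Int.fract (Int.fract _) < _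
    rw [Int.fract_fract]
    change cantorT q n x < _
    nlinarith
  · refine dimH_eq_one_of_isInfiniteInLimit hq hinf fun x hx hnormal => ?_
    have h1 := hnormal fun _ => 0
    simp only [blockCount_zero_eq_zero (fun j hj => (Nat.one_le_iff_ne_zero.mp (hx j hj).1))
      two_pos, Nat.cast_zero, zero_div] at h1
    exact zero_ne_one (tendsto_nhds_unique tendsto_const_nhds h1)
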